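/- Let $n\ge 1$, let $U^n=\{z\in\mathbb{C}^n : |z_j|<1 \text{ for } j=1,\dots,n\}$ be the open unit polydisc, and let $0<\alpha<1$. Let $L_{1-\alpha}(U^n)$ be the space of all holomorphic functions $f:U^n\to\mathbb{C}$ with $$\|f\|_{1-\alpha}=\sup_{z\in U^n}\sum_{j=1}^n(1-|z_j|^2)^{\alpha}\left|\frac{\partial f}{\partial z_j}(z)\right|<\infty,$$ normed by $\|f\|=|f(0)|+\|f\|_{1-\alpha}$. Let $\varphi=(\varphi_1,\dots,\varphi_n):U^n\to U^n$ be holomorphic, and let $C_\varphi f=f\circ\varphi$. Then $C_\varphi$ is a compact operator on $L_{1-\alpha}(U^n)$ (that is, it maps $L_{1-\alpha}(U^n)$ into itself and is compact with respect to the norm above) if and only if, for every $j=1,\dots,n$, $\varphi_j\in L_{1-\alpha}(U^n)$ and $\|\varphi_j\|_\infty=\sup_{z\in U^n}|\varphi_j(z)|<1$. -/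

import Mathlib

namespace PolydiscLip

noncomputable section

/-- The open unit polydisc `U^n` in `ℂ^n`. -/
def polydisc (n : ℕ) : Set (Fin n → ℂ) := {z | ∀ j, ‖z j‖ < 1}

theorem polydisc_eq_ball (n : ℕ) : polydisc n = Metric.ball 0 1 := by
  ext z
  simp [polydisc, pi_norm_lt_iff]

theorem isOpen_polydisc (n : ℕ) : IsOpen (polydisc n) := by
  rw [polydisc_eq_ball]; exact Metric.isOpen_ball

theorem convex_polydisc (n : ℕ) : Convex ℝ (polydisc n) := by
  rw [polydisc_eq_ball]; exact convex_ball 0 1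

/-- The centre of the polydisc, as a point of it. -/
def origin (n : ℕ) : polydisc n := ⟨0, by simp [polydisc]⟩

/-- Extension by zero to `ℂ^n`; all derivatives below are taken at points of the (open) polydisc,
so the values outside play no role. -/
def ext0 {n : ℕ} (f : polydisc n → ℂ) : (Fin n → ℂ) → ℂ := Function.extend Subtype.val f 0

theorem ext0_apply {n : ℕ} (f : polydisc n → ℂ) (z : polydisc n) : ext0 f z = f z :=
  Subtype.val_injective.extend_apply _ _ _

theorem ext0_zero {n : ℕ} : ext0 (0 : polydisc n → ℂ) = 0 :=
  Function.extend_zero _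

theorem ext0_add {n : ℕ} (f g : polydisc n → ℂ) : ext0 (f + g) = ext0 f + ext0 g := by
  simpa [ext0] using Function.extend_add (Subtype.val : polydisc n → _) f g 0 0

theorem ext0_smul {n : ℕ} (c : ℂ) (f : polydisc n → ℂ) : ext0 (c • f) = c • ext0 f := by
  simpa [ext0] using Function.extend_smul c (Subtype.val : polydisc n → _) f 0

/-- `f ∈ H(U^n)`: holomorphic functions on the polydisc. -/
def Holo {n : ℕ} (f : polydisc n → ℂ) : Prop := DifferentiableOn ℂ (ext0 f) (polydisc n)

/-- The partial derivative `∂f/∂z_j (z)`. -/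
def partialDeriv {n : ℕ} (f : polydisc n → ℂ) (j : Fin n) (z : polydisc n) : ℂ :=
  fderiv ℂ (ext0 f) z (Pi.single j 1)

/-- `∑_j (1 - |z_j|²)^α |∂f/∂z_j (z)|`. -/
def weightedGrad {n : ℕ} (α : ℝ) (f : polydisc n → ℂ) (z : polydisc n) : ℝ :=
  ∑ j, (1 - ‖z.1 j‖ ^ 2) ^ α * ‖partialDeriv f j z‖

/-- `‖f‖_{1-α}`, the supremum over `U^n` of the weighted gradient (used for functions for which the
supremum is finite). -/
def lipSeminorm {n : ℕ} (α : ℝ) (f : polydisc n → ℂ) : ℝ := ⨆ z, weightedGrad α f z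

/-- Membership in the space `L_{1-α}(U^n)`: holomorphic with finite `‖f‖_{1-α}`. -/
def MemLip {n : ℕ} (α : ℝ) (f : polydisc n → ℂ) : Prop :=
  Holo f ∧ BddAbove (Set.range (weightedGrad α f))

section basic

variable {n : ℕ} {α : ℝ} {f g : polydisc n → ℂ}

theorem Holo.differentiableAt (hf : Holo f) (z : polydisc n) :
    DifferentiableAt ℂ (ext0 f) z :=
  (hf z z.2).differentiableAt ((isOpen_polydisc n).mem_nhds z.2)

theorem partialDeriv_add (hf : Holo f) (hg : Holo g) (j : Fin n) (z : polydisc n) :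
    partialDeriv (f + g) j z = partialDeriv f j z + partialDeriv g j z := by
  unfold partialDeriv
  rw [ext0_add, fderiv_add (hf.differentiableAt z) (hg.differentiableAt z)]
  rfl

theorem partialDeriv_smul (hf : Holo f) (c : ℂ) (j : Fin n) (z : polydisc n) :
    partialDeriv (c • f) j z = c * partialDeriv f j z := by
  unfold partialDeriv
  rw [ext0_smul, fderiv_const_smul (hf.differentiableAt z)]
  rfl

theorem weight_pos (α : ℝ) (z : polydisc n) (j : Fin n) : 0 < (1 - ‖z.1 j‖ ^ 2) ^ α := by
  apply Real.rpow_pos_of_pos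
  have := z.2 j
  nlinarith [norm_nonneg (z.1 j)]

theorem weightedGrad_nonneg (α : ℝ) (f : polydisc n → ℂ) (z : polydisc n) :
    0 ≤ weightedGrad α f z :=
  Finset.sum_nonneg fun j _ => mul_nonneg (weight_pos α z j).le (norm_nonneg _)

theorem weightedGrad_add (hf : Holo f) (hg : Holo g) (z : polydisc n) :
    weightedGrad α (f + g) z ≤ weightedGrad α f z + weightedGrad α g z := by
  unfold weightedGrad
  rw [← Finset.sum_add_distrib]
  refine Finset.sum_le_sum fun j _ => ?_
  rw [partialDeriv_add hf hg, ← mul_add]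
  exact mul_le_mul_of_nonneg_left (norm_add_le _ _) (weight_pos α z j).le

theorem weightedGrad_smul (hf : Holo f) (c : ℂ) (z : polydisc n) :
    weightedGrad α (c • f) z = ‖c‖ * weightedGrad α f z := by
  unfold weightedGrad
  rw [Finset.mul_sum]
  refine Finset.sum_congr rfl fun j _ => ?_
  rw [partialDeriv_smul hf, norm_mul]
  ring

theorem holo_zero : Holo (0 : polydisc n → ℂ) := by
  unfold Holo
  rw [ext0_zero]
  exact differentiableOn_const 0

theorem weightedGrad_zero (z : polydisc n) : weightedGrad α (0 : polydisc n → ℂ) z = 0 := by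
  simpa using weightedGrad_smul (α := α) (holo_zero (n := n)) 0 z

theorem memLip_zero : MemLip α (0 : polydisc n → ℂ) := by
  refine ⟨holo_zero, 0, ?_⟩
  rintro _ ⟨z, rfl⟩
  exact (weightedGrad_zero z).le

theorem MemLip.weightedGrad_le (hf : MemLip α f) (z : polydisc n) :
    weightedGrad α f z ≤ lipSeminorm α f :=
  le_ciSup hf.2 z

theorem lipSeminorm_nonneg (α : ℝ) (f : polydisc n → ℂ) : 0 ≤ lipSeminorm α f :=
  Real.iSup_nonneg fun z => weightedGrad_nonneg α f z

theorem MemLip.add (hf : MemLip α f) (hg : MemLip α g) : MemLip α (f + g) := by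
  refine ⟨?_, lipSeminorm α f + lipSeminorm α g, ?_⟩
  · unfold Holo
    rw [ext0_add]
    exact hf.1.add hg.1
  · rintro _ ⟨z, rfl⟩
    exact (weightedGrad_add hf.1 hg.1 z).trans
      (add_le_add (hf.weightedGrad_le z) (hg.weightedGrad_le z))

theorem MemLip.smul (hf : MemLip α f) (c : ℂ) : MemLip α (c • f) := by
  refine ⟨?_, ‖c‖ * lipSeminorm α f, ?_⟩
  · unfold Holo
    rw [ext0_smul]
    exact DifferentiableOn.const_smul hf.1 c
  · rintro _ ⟨z, rfl⟩
    rw [weightedGrad_smul hf.1]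
    exact mul_le_mul_of_nonneg_left (hf.weightedGrad_le z) (norm_nonneg c)

theorem lipSeminorm_add (hf : MemLip α f) (hg : MemLip α g) :
    lipSeminorm α (f + g) ≤ lipSeminorm α f + lipSeminorm α g :=
  Real.iSup_le (fun z => (weightedGrad_add hf.1 hg.1 z).trans
    (add_le_add (hf.weightedGrad_le z) (hg.weightedGrad_le z)))
    (add_nonneg (lipSeminorm_nonneg α f) (lipSeminorm_nonneg α g))

theorem lipSeminorm_smul (hf : MemLip α f) (c : ℂ) :
    lipSeminorm α (c • f) = ‖c‖ * lipSeminorm α f := by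
  unfold lipSeminorm
  rw [Real.mul_iSup_of_nonneg (norm_nonneg c)]
  exact iSup_congr fun z => weightedGrad_smul hf.1 c z

theorem eq_zero_of_lipNorm (hf : MemLip α f) (h0 : f (origin n) = 0)
    (h : lipSeminorm α f = 0) : f = 0 := by
  have hz : ∀ z ∈ polydisc n, fderiv ℂ (ext0 f) z = 0 := by
    intro z hz
    have h1 : weightedGrad α f ⟨z, hz⟩ = 0 :=
      le_antisymm (h ▸ hf.weightedGrad_le ⟨z, hz⟩) (weightedGrad_nonneg _ _ _)
    have h2 : ∀ j, fderiv ℂ (ext0 f) z (Pi.single j 1) = 0 := by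
      intro j
      have h3 := (Finset.sum_eq_zero_iff_of_nonneg (fun j _ =>
        mul_nonneg (weight_pos α ⟨z, hz⟩ j).le (norm_nonneg _))).1 h1 j (Finset.mem_univ j)
      exact norm_eq_zero.1 ((mul_eq_zero.1 h3).resolve_left (weight_pos α ⟨z, hz⟩ j).ne')
    ext v
    rw [pi_eq_sum_univ' v, map_sum]
    refine Finset.sum_eq_zero fun j _ => ?_
    rw [map_smul]
    simp [h2]
  funext z
  have h4 := (isOpen_polydisc n).is_const_of_fderiv_eq_zero
    (convex_polydisc n).isPreconnected hf.1 hz z.2 (origin n).2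
  rw [ext0_apply, ext0_apply, h0] at h4
  exact h4

end basic

/-- `L_{1-α}(U^n)` as a linear subspace of the space of functions on `U^n`. -/
def lipSubmodule (n : ℕ) (α : ℝ) : Submodule ℂ (polydisc n → ℂ) where
  carrier := {f | MemLip α f}
  zero_mem' := memLip_zero
  add_mem' := fun hf hg => MemLip.add hf hg
  smul_mem' := fun c _ hf => MemLip.smul hf c

/-- The space `L_{1-α}(U^n)`, as a type of its own, so that its topology is that of its norm and not
the one of pointwise convergence. -/
def LipSpace (n : ℕ) (α : ℝ) : Type := lipSubmodule n α

instance (n : ℕ) (α : ℝ) : AddCommGroup (LipSpace n α) :=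
  inferInstanceAs (AddCommGroup (lipSubmodule n α))

instance (n : ℕ) (α : ℝ) : Module ℂ (LipSpace n α) :=
  inferInstanceAs (Module ℂ (lipSubmodule n α))

/-- The elements of `L_{1-α}(U^n)` are functions on `U^n`. -/
instance (n : ℕ) (α : ℝ) : CoeFun (LipSpace n α) (fun _ => polydisc n → ℂ) :=
  ⟨fun f => f.1⟩

/-- The norm `‖f‖ = |f(0)| + ‖f‖_{1-α}`. -/
def lipNorm (n : ℕ) (α : ℝ) : AddGroupNorm (LipSpace n α) where
  toFun f := ‖f (origin n)‖ + lipSeminorm α f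
  map_zero' := by
    have h : lipSeminorm α (0 : polydisc n → ℂ) = 0 := by
      simp [lipSeminorm, weightedGrad_zero]
    change ‖(0 : ℂ)‖ + lipSeminorm α (0 : polydisc n → ℂ) = 0
    simp [h]
  add_le' f g := by
    have h1 := norm_add_le (f (origin n)) (g (origin n))
    have h2 := lipSeminorm_add f.2 g.2
    change ‖f (origin n) + g (origin n)‖ + lipSeminorm α (f.1 + g.1) ≤ _
    linarith
  neg' f := by
    have h := lipSeminorm_smul f.2 (-1)
    rw [neg_one_smul, norm_neg, norm_one, one_mul] at h
    change ‖-(f (origin n))‖ + lipSeminorm α (-f.1) = _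
    rw [h, norm_neg]
  eq_zero_of_map_eq_zero' f h := by
    have h1 := norm_nonneg (f (origin n))
    have h2 := lipSeminorm_nonneg α f.1
    exact Subtype.ext (eq_zero_of_lipNorm f.2 (norm_eq_zero.1 (by linarith)) (by linarith))

instance (n : ℕ) (α : ℝ) : NormedAddCommGroup (LipSpace n α) :=
  (lipNorm n α).toNormedAddCommGroup

theorem LipSpace.norm_def {n : ℕ} {α : ℝ} (f : LipSpace n α) :
    ‖f‖ = ‖f (origin n)‖ + lipSeminorm α f := rfl

instance (n : ℕ) (α : ℝ) : NormedSpace ℂ (LipSpace n α) where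
  norm_smul_le c f := by
    change ‖c * f (origin n)‖ + lipSeminorm α (c • f.1) ≤
      ‖c‖ * (‖f (origin n)‖ + lipSeminorm α f.1)
    rw [lipSeminorm_smul f.2, norm_mul, mul_add]

/-- A self-map of the polydisc is holomorphic when all its components are. -/
def HoloSelfMap {n : ℕ} (φ : polydisc n → polydisc n) : Prop :=
  ∀ j, Holo fun z => (φ z).1 j

/-- The composition operator `C_φ f = f ∘ φ` is compact on `L_{1-α}(U^n)`: it maps the space into
itself, and as an operator on this normed space it is compact. -/
def CompactCompOp {n : ℕ} (α : ℝ) (φ : polydisc n → polydisc n) : Prop :=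
  ∃ T : LipSpace n α →ₗ[ℂ] LipSpace n α,
    (∀ (f : LipSpace n α) (z : polydisc n), T f z = f (φ z)) ∧ IsCompactOperator T

end

end PolydiscLip

namespace PolydiscLip

noncomputable section

open Filter Topology ComplexConjugate

/-! ### Growth estimates and completeness of the space. -/

section estimates

variable {n : ℕ} {α : ℝ} {f g : polydisc n → ℂ}

/-! Since `α < 1`, the weight `(1 - s)^(-α)` is integrable at `1`, so gradient bounds integrate
along radii up to the boundary: the norm controls the sup norm, and `f` is Hölder of order `1 - α`
on radii (`MemLip.norm_sub_dilate_le`).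

Sufficiency: if `φ` maps into a ball of radius `r < r' < 1`, the chain rule and Cauchy's estimate
bound the norm of `f ∘ φ` by a constant times the supremum of `|f|` on the closed ball of radius
`r'`. Arzelà–Ascoli makes the unit ball totally bounded for that supremum, and completeness turns
this into compactness.

Necessity: `φ_j` is the image of a coordinate function. If `‖φ_j‖_∞ = 1`, take `kernelFun` at `w =
φ_j(z_m)` with `|w| → 1`. These functions are bounded in norm and tend uniformly to `0`, so by
compactness their images tend to `0` in norm along a subsequence. Yet along the radius to `z_m` the
image drops from `d^(1-α)` to at most half of it over a distance comparable to `d = 1 - |w|²`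
(Schwarz–Pick), so the Hölder estimate keeps its seminorm away from `0`
(`le_lipSeminorm_kernelFun_comp`). -/

theorem fderiv_ext0_apply (f : polydisc n → ℂ) (z : polydisc n) (v : Fin n → ℂ) :
    fderiv ℂ (ext0 f) z v = ∑ j, v j * partialDeriv f j z := by
  conv_lhs => rw [pi_eq_sum_univ' v, map_sum]
  simp only [partialDeriv, map_smul, smul_eq_mul]

theorem norm_fderiv_ext0_apply_le (f : polydisc n → ℂ) (z : polydisc n) (v : Fin n → ℂ) :
    ‖fderiv ℂ (ext0 f) z v‖ ≤ (∑ j, ‖partialDeriv f j z‖) * ‖v‖ := by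
  rw [fderiv_ext0_apply, Finset.sum_mul]
  refine (norm_sum_le _ _).trans (Finset.sum_le_sum fun j _ => ?_)
  rw [norm_mul, mul_comm]
  exact mul_le_mul_of_nonneg_left (norm_le_pi_norm v j) (norm_nonneg _)

theorem norm_fderiv_ext0_le (f : polydisc n → ℂ) (z : polydisc n) :
    ‖fderiv ℂ (ext0 f) z‖ ≤ ∑ j, ‖partialDeriv f j z‖ :=
  ContinuousLinearMap.opNorm_le_bound _ (Finset.sum_nonneg fun _ _ => norm_nonneg _)
    (norm_fderiv_ext0_apply_le f z)

theorem norm_lt_one (z : polydisc n) : ‖z.1‖ < 1 := by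
  simpa using (polydisc_eq_ball n).subset z.2

theorem mem_polydisc_of_norm_le {z : Fin n → ℂ} {s : ℝ} (hs : s < 1) (hz : ‖z‖ ≤ s) :
    z ∈ polydisc n := by
  rw [polydisc_eq_ball]
  simpa using hz.trans_lt hs

theorem sum_norm_partialDeriv_mul_le (hα : 0 ≤ α) (f : polydisc n → ℂ) (z : polydisc n) {s : ℝ}
    (hs : s < 1) (hz : ‖z.1‖ ≤ s) :
    (∑ j, ‖partialDeriv f j z‖) * (1 - s) ^ α ≤ weightedGrad α f z := by
  rw [weightedGrad, Finset.sum_mul]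
  refine Finset.sum_le_sum fun j _ => ?_
  rw [mul_comm]
  refine mul_le_mul_of_nonneg_right (Real.rpow_le_rpow (by linarith) ?_ hα) (norm_nonneg _)
  have h1 := (norm_le_pi_norm z.1 j).trans hz
  nlinarith [norm_nonneg (z.1 j)]

theorem MemLip.sum_norm_partialDeriv_le (hα : 0 ≤ α) (hf : MemLip α f) (z : polydisc n) {s : ℝ}
    (hs : s < 1) (hz : ‖z.1‖ ≤ s) :
    ∑ j, ‖partialDeriv f j z‖ ≤ lipSeminorm α f / (1 - s) ^ α := by
  rw [le_div_iff₀ (Real.rpow_pos_of_pos (by linarith) α)]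
  exact (sum_norm_partialDeriv_mul_le hα f z hs hz).trans (hf.weightedGrad_le z)

theorem MemLip.norm_fderiv_ext0_le (hα : 0 ≤ α) (hf : MemLip α f) {z : Fin n → ℂ} {s : ℝ}
    (hs : s < 1) (hz : ‖z‖ ≤ s) :
    ‖fderiv ℂ (ext0 f) z‖ ≤ lipSeminorm α f / (1 - s) ^ α :=
  (PolydiscLip.norm_fderiv_ext0_le f ⟨z, mem_polydisc_of_norm_le hs hz⟩).trans
    (hf.sum_norm_partialDeriv_le hα ⟨z, mem_polydisc_of_norm_le hs hz⟩ hs hz)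

/-- The point `t z` of the polydisc, for `0 ≤ t ≤ 1`. -/
def dilate (z : polydisc n) (t : ℝ) (ht : t ∈ Set.Icc (0 : ℝ) 1) : polydisc n :=
  ⟨(t : ℂ) • z.1, mem_polydisc_of_norm_le (norm_lt_one z) (by
    rw [norm_smul, Complex.norm_real, Real.norm_of_nonneg ht.1]
    exact mul_le_of_le_one_left (norm_nonneg _) ht.2)⟩

theorem norm_dilate_le (z : polydisc n) (t : ℝ) (ht : t ∈ Set.Icc (0 : ℝ) 1) :
    ‖(dilate z t ht).1‖ ≤ t := by
  change ‖(t : ℂ) • z.1‖ ≤ t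
  rw [norm_smul, Complex.norm_real, Real.norm_of_nonneg ht.1]
  exact mul_le_of_le_one_right ht.1 (norm_lt_one z).le

/-- Functions in `L_{1-α}` are Hölder continuous of order `1 - α` along radii. -/
theorem MemLip.norm_sub_dilate_le (hα0 : 0 < α) (hα1 : α < 1) (hf : MemLip α f) (z : polydisc n)
    (t : ℝ) (ht : t ∈ Set.Icc (0 : ℝ) 1) :
    ‖f z - f (dilate z t ht)‖ ≤ lipSeminorm α f * (1 - t) ^ (1 - α) / (1 - α) := by
  set γ : ℝ → (Fin n → ℂ) := fun s => (s : ℂ) • z.1 with hγ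
  have hγd : ∀ s : ℝ, HasDerivAt γ z.1 s := fun s => by
    refine ((Complex.ofRealCLM.hasDerivAt (x := s)).smul_const z.1).congr_deriv ?_
    simp
  have hmem : ∀ s ∈ Set.Icc t 1, γ s ∈ polydisc n := fun s hs =>
    (dilate z s ⟨ht.1.trans hs.1, hs.2⟩).2
  have hd : ∀ s ∈ Set.Icc t 1,
      HasDerivAt (fun s => ext0 f (γ s)) (fderiv ℂ (ext0 f) (γ s) z.1) s := by
    intro s hs
    have h := (hf.1.differentiableAt ⟨γ s, hmem s hs⟩).hasFDerivAt.restrictScalars ℝ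
    exact h.comp_hasDerivAt s (hγd s)
  -- The integral of `‖f‖_{1-α} (1 - σ)^(-α)` over `σ` from `t` to `s`. Derivative bounds are
  -- required only on `[t, 1)`, so the singularity at `1` is harmless.
  set B : ℝ → ℝ := fun s =>
    lipSeminorm α f / (1 - α) * ((1 - t) ^ (1 - α) - (1 - s) ^ (1 - α)) with hB
  have key := image_norm_le_of_norm_deriv_right_le_deriv_boundary'
    (f := fun s => ext0 f (γ s) - ext0 f (γ t)) (a := t) (b := 1)
    (f' := fun s => fderiv ℂ (ext0 f) (γ s) z.1) (B := B)
    (B' := fun s => lipSeminorm α f / (1 - s) ^ α) ?_ ?_ ?_ ?_ ?_ ?_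
    (Set.right_mem_Icc.2 ht.2)
  · have e1 : ext0 f (γ 1) = f z := by
      rw [← ext0_apply f z]; simp [hγ]
    have e2 : ext0 f (γ t) = f (dilate z t ht) := ext0_apply f (dilate z t ht)
    simp only [e1, e2, hB, sub_self] at key
    rw [Real.zero_rpow (by linarith), sub_zero] at key
    calc _ ≤ _ := key
      _ = _ := by ring
  · exact fun s hs => ((hd s hs).continuousAt.sub continuousAt_const).continuousWithinAt
  · exact fun s hs => ((hd s ⟨hs.1, hs.2.le⟩).sub_const _).hasDerivWithinAt
  · simp [hB]
  · refine ContinuousOn.mul continuousOn_const (continuousOn_const.sub ?_)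
    exact ((continuous_const.sub continuous_id).rpow_const
      fun s => Or.inr (by linarith)).continuousOn
  · intro s hs
    have hs1 : 0 < 1 - s := by linarith [hs.2]
    have h1 : HasDerivAt (fun s : ℝ => (1 - s) ^ (1 - α)) (-1 * (1 - α) * (1 - s) ^ (1 - α - 1)) s :=
      ((hasDerivAt_id s).const_sub 1).rpow_const (Or.inl hs1.ne')
    have h2 := ((h1.const_sub ((1 - t) ^ (1 - α))).const_mul (lipSeminorm α f / (1 - α)))
    refine (h2.congr_deriv ?_).hasDerivWithinAt
    rw [show 1 - α - 1 = -α by ring, Real.rpow_neg hs1.le]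
    have : 1 - α ≠ 0 := by linarith
    field_simp
  · intro s hs
    have h0 : s ∈ Set.Icc (0 : ℝ) 1 := ⟨ht.1.trans hs.1, hs.2.le⟩
    have h1 := hf.norm_fderiv_ext0_le hα0.le hs.2 (norm_dilate_le z s h0)
    exact ((fderiv ℂ (ext0 f) (γ s)).le_of_opNorm_le_of_le h1 (norm_lt_one z).le).trans
      (mul_one _).le

theorem dilate_zero (z : polydisc n) (h : (0 : ℝ) ∈ Set.Icc (0 : ℝ) 1) :
    dilate z 0 h = origin n := by
  apply Subtype.ext
  simp [dilate, origin]

/-- The supremum norm is dominated by the norm of `L_{1-α}`. -/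
theorem LipSpace.norm_apply_le (hα0 : 0 < α) (hα1 : α < 1) (f : LipSpace n α) (z : polydisc n) :
    ‖f z‖ ≤ ‖f‖ / (1 - α) := by
  have h1 := MemLip.norm_sub_dilate_le hα0 hα1 f.2 z 0 (by simp)
  rw [dilate_zero, sub_zero, Real.one_rpow, mul_one] at h1
  have h2 : ‖f z‖ ≤ ‖f (origin n)‖ + ‖f z - f (origin n)‖ := by
    simpa using norm_add_le (f (origin n)) (f z - f (origin n))
  have h3 : ‖f (origin n)‖ ≤ ‖f (origin n)‖ / (1 - α) :=
    le_div_self (norm_nonneg _) (by linarith) (by linarith)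
  rw [LipSpace.norm_def, add_div]
  linarith

theorem LipSpace.lipSeminorm_le_norm (f : LipSpace n α) : lipSeminorm α f.1 ≤ ‖f‖ := by
  rw [LipSpace.norm_def]
  linarith [norm_nonneg (f (origin n))]

theorem LipSpace.ext0_sub (f g : LipSpace n α) : ext0 (f - g).1 = ext0 f.1 - ext0 g.1 := by
  have h : (f - g).1 = f.1 + (-1 : ℂ) • g.1 := by
    rw [neg_one_smul, ← sub_eq_add_neg]; rfl
  rw [h, PolydiscLip.ext0_add, PolydiscLip.ext0_smul, neg_one_smul, sub_eq_add_neg]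

theorem hasFDerivAt_ext0 (f : LipSpace n α) {z : Fin n → ℂ} (hz : z ∈ polydisc n) :
    HasFDerivAt (ext0 f.1) (fderiv ℂ (ext0 f.1) z) z :=
  (Holo.differentiableAt f.2.1 ⟨z, hz⟩).hasFDerivAt

theorem LipSpace.fderiv_ext0_sub (f g : LipSpace n α) {z : Fin n → ℂ} (hz : z ∈ polydisc n) :
    fderiv ℂ (ext0 (f - g).1) z = fderiv ℂ (ext0 f.1) z - fderiv ℂ (ext0 g.1) z := by
  rw [LipSpace.ext0_sub]
  exact ((hasFDerivAt_ext0 f hz).sub (hasFDerivAt_ext0 g hz)).fderiv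

/-- The sup-norm bound gives a pointwise limit, and uniform convergence of derivatives on smaller
balls makes it holomorphic. Letting `k → ∞` in the weighted gradient of `u m - u k` gives
convergence in norm. -/
theorem LipSpace.exists_tendsto_of_cauchySeq (hα0 : 0 < α) (hα1 : α < 1) (u : ℕ → LipSpace n α)
    (hu : CauchySeq u) : ∃ g : LipSpace n α, Tendsto u atTop (𝓝 g) := by
  have hpt : ∀ z : polydisc n, ∃ w : ℂ, Tendsto (fun m => u m z) atTop (𝓝 w) := by
    intro z
    refine cauchySeq_tendsto_of_complete ?_
    rw [Metric.cauchySeq_iff] at hu ⊢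
    intro ε hε
    obtain ⟨N, hN⟩ := hu (ε * (1 - α)) (mul_pos hε (by linarith))
    refine ⟨N, fun m hm k hk => ?_⟩
    have h1 := LipSpace.norm_apply_le hα0 hα1 (u m - u k) z
    rw [dist_eq_norm]
    refine h1.trans_lt ?_
    rw [div_lt_iff₀ (by linarith), ← dist_eq_norm]
    exact hN m hm k hk
  choose g hg using hpt
  have hder_cauchy : ∀ s < 1, UniformCauchySeqOn (fun m z => fderiv ℂ (ext0 (u m).1) z) atTop
      (Metric.ball (0 : Fin n → ℂ) s) := by
    intro s hs
    rw [Metric.uniformCauchySeqOn_iff]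
    intro ε hε
    have hp : 0 < (1 - s) ^ α := Real.rpow_pos_of_pos (by linarith) α
    obtain ⟨N, hN⟩ := Metric.cauchySeq_iff.1 hu (ε * (1 - s) ^ α) (mul_pos hε hp)
    refine ⟨N, fun m hm k hk z hz => ?_⟩
    have hz' : ‖z‖ ≤ s := by simpa using (Metric.mem_ball.1 hz).le
    have h1 := MemLip.norm_fderiv_ext0_le hα0.le (u m - u k).2 hs hz'
    rw [LipSpace.fderiv_ext0_sub _ _ (mem_polydisc_of_norm_le hs hz')] at h1
    rw [dist_eq_norm]
    refine h1.trans_lt ?_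
    rw [div_lt_iff₀ hp]
    refine (LipSpace.lipSeminorm_le_norm _).trans_lt ?_
    rw [← dist_eq_norm]
    exact hN m hm k hk
  have hder : ∀ z : polydisc n, ∃ A, Tendsto (fun m => fderiv ℂ (ext0 (u m).1) z) atTop (𝓝 A) := by
    intro z
    obtain ⟨s, hs1, hs2⟩ := exists_between (norm_lt_one z)
    exact cauchySeq_tendsto_of_complete ((hder_cauchy s hs2).cauchySeq (by simpa using hs1))
  choose A hA using hder
  have hfd : ∀ z : polydisc n, HasFDerivAt (ext0 g) (A z) z := by
    intro z
    obtain ⟨s, hs1, hs2⟩ := exists_between (norm_lt_one z)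
    have hmem : ∀ x ∈ Metric.ball (0 : Fin n → ℂ) s, x ∈ polydisc n := fun x hx =>
      mem_polydisc_of_norm_le hs2 (by simpa using (Metric.mem_ball.1 hx).le)
    classical
    have h := hasFDerivAt_of_tendstoUniformlyOn (f := fun m => ext0 (u m).1) (g := ext0 g)
      (g' := fun x => if hx : x ∈ polydisc n then A ⟨x, hx⟩ else 0) (x := z.1)
      Metric.isOpen_ball
      ((hder_cauchy s hs2).tendstoUniformlyOn_of_tendsto fun x hx => by
        simpa [hmem x hx] using hA ⟨x, hmem x hx⟩)
      (fun m x hx => hasFDerivAt_ext0 (u m) (hmem x hx))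
      (fun x hx => by
        have := hg ⟨x, hmem x hx⟩
        rw [← ext0_apply g] at this
        simpa only [← ext0_apply] using this)
      (by simpa using hs1)
    simpa using h
  have hgholo : Holo g := fun z hz => (hfd ⟨z, hz⟩).differentiableAt.differentiableWithinAt
  have hwg : ∀ m z, Tendsto (fun k => weightedGrad α (u m - u k).1 z) atTop
      (𝓝 (weightedGrad α ((u m).1 - g) z)) := by
    intro m z
    have hpd : ∀ j, Tendsto (fun k => partialDeriv (u m - u k).1 j z) atTop
        (𝓝 (partialDeriv ((u m).1 - g) j z)) := by
      intro j
      have h1 : partialDeriv ((u m).1 - g) j z =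
          fderiv ℂ (ext0 (u m).1) z (Pi.single j 1) - A z (Pi.single j 1) := by
        have h : (u m).1 - g = (u m).1 + (-1 : ℂ) • g := by
          rw [neg_one_smul, ← sub_eq_add_neg]
        rw [partialDeriv, h, PolydiscLip.ext0_add, PolydiscLip.ext0_smul, neg_one_smul,
          ← sub_eq_add_neg, ((hasFDerivAt_ext0 (u m) z.2).sub (hfd z)).fderiv]
        rfl
      rw [h1]
      simp only [partialDeriv, LipSpace.fderiv_ext0_sub _ _ z.2]
      exact tendsto_const_nhds.sub (((ContinuousLinearMap.apply ℂ ℂ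
        (Pi.single j 1 : Fin n → ℂ)).continuous.tendsto _).comp (hA z))
    exact tendsto_finsetSum _ fun j _ => (hpd j).norm.const_mul _
  have hlim : ∀ ε > 0, ∃ N, ∀ m ≥ N, ∀ z, weightedGrad α ((u m).1 - g) z ≤ ε := by
    intro ε hε
    obtain ⟨N, hN⟩ := Metric.cauchySeq_iff.1 hu ε hε
    refine ⟨N, fun m hm z => le_of_tendsto (hwg m z) ?_⟩
    filter_upwards [eventually_ge_atTop N] with k hk
    refine (MemLip.weightedGrad_le (u m - u k).2 z).trans
      ((LipSpace.lipSeminorm_le_norm _).trans ?_)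
    rw [← dist_eq_norm]
    exact (hN m hm k hk).le
  have hgmem : MemLip α g := by
    obtain ⟨N, hN⟩ := hlim 1 one_pos
    have hd : MemLip α ((u N).1 - g) := by
      refine ⟨?_, 1, ?_⟩
      · have h : (u N).1 - g = (u N).1 + (-1 : ℂ) • g := by
          rw [neg_one_smul, ← sub_eq_add_neg]
        unfold Holo
        rw [h, PolydiscLip.ext0_add, PolydiscLip.ext0_smul]
        exact DifferentiableOn.add (u N).2.1 (DifferentiableOn.const_smul hgholo _)
      · rintro _ ⟨z, rfl⟩
        exact hN N le_rfl z
    have h := MemLip.add (u N).2 (hd.smul (-1))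
    have e : (u N).1 + (-1 : ℂ) • ((u N).1 - g) = g := by
      rw [neg_one_smul]; abel
    rwa [e] at h
  obtain ⟨G, rfl⟩ : ∃ G : LipSpace n α, G.1 = g := ⟨⟨g, hgmem⟩, rfl⟩
  refine ⟨G, Metric.tendsto_atTop.2 fun ε hε => ?_⟩
  obtain ⟨N, hN⟩ := hlim (ε / 3) (by positivity)
  obtain ⟨N', hN'⟩ := Metric.tendsto_atTop.1 (hg (origin n)) (ε / 3) (by positivity)
  refine ⟨max N N', fun m hm => ?_⟩
  have h1 : lipSeminorm α ((u m).1 - G.1) ≤ ε / 3 :=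
    Real.iSup_le (hN m ((le_max_left _ _).trans hm)) (by positivity)
  have h2 : ‖u m (origin n) - G (origin n)‖ < ε / 3 := by
    rw [← dist_eq_norm]
    exact hN' m ((le_max_right _ _).trans hm)
  rw [dist_eq_norm, LipSpace.norm_def]
  change ‖u m (origin n) - G (origin n)‖ + lipSeminorm α ((u m).1 - G.1) < ε
  linarith

theorem LipSpace.completeSpace (hα0 : 0 < α) (hα1 : α < 1) : CompleteSpace (LipSpace n α) :=
  Metric.complete_of_cauchySeq_tendsto (LipSpace.exists_tendsto_of_cauchySeq hα0 hα1)

end estimates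

/-! ### Composition with a map into a smaller ball is compact. -/

section sufficiency

variable {n : ℕ} {α : ℝ} {f g : polydisc n → ℂ} {φ : polydisc n → polydisc n}

theorem hasFDerivAt_ext0_comp (hf : Holo f) (hφ : HoloSelfMap φ) (z : polydisc n) :
    HasFDerivAt (ext0 (f ∘ φ)) ((fderiv ℂ (ext0 f) (φ z)).comp
      (ContinuousLinearMap.pi fun j => fderiv ℂ (ext0 fun z => (φ z).1 j) z)) z := by
  have h1 : HasFDerivAt (fun x j => ext0 (fun z => (φ z).1 j) x)
      (ContinuousLinearMap.pi fun j => fderiv ℂ (ext0 fun z => (φ z).1 j) z) z.1 :=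
    hasFDerivAt_pi.2 fun j => ((hφ j).differentiableAt z).hasFDerivAt
  have h2 : ∀ w : polydisc n, (fun j => ext0 (fun z => (φ z).1 j) w.1) = (φ w).1 := fun w => by
    funext j
    rw [ext0_apply]
  have h3 : HasFDerivAt (ext0 f) (fderiv ℂ (ext0 f) (φ z))
      (fun j => ext0 (fun z => (φ z).1 j) z.1) := by
    rw [h2]
    exact (hf.differentiableAt (φ z)).hasFDerivAt
  refine (h3.comp z.1 h1).congr_of_eventuallyEq ?_
  filter_upwards [(isOpen_polydisc n).mem_nhds z.2] with w hw
  have h4 := h2 ⟨w, hw⟩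
  simp only [Function.comp_apply] at h4 ⊢
  rw [h4, ext0_apply]
  exact ext0_apply (f ∘ φ) ⟨w, hw⟩

theorem Holo.comp (hf : Holo f) (hφ : HoloSelfMap φ) : Holo (f ∘ φ) := fun z hz =>
  (hasFDerivAt_ext0_comp hf hφ ⟨z, hz⟩).differentiableAt.differentiableWithinAt

theorem partialDeriv_comp (hf : Holo f) (hφ : HoloSelfMap φ) (k : Fin n) (z : polydisc n) :
    partialDeriv (f ∘ φ) k z =
      ∑ j, partialDeriv (fun z => (φ z).1 j) k z * partialDeriv f j (φ z) := by
  rw [partialDeriv, (hasFDerivAt_ext0_comp hf hφ z).fderiv, ContinuousLinearMap.comp_apply,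
    fderiv_ext0_apply]
  rfl

/-- In the chain rule the weights at `z` are absorbed by the gradients of the `φ_j`, so `f` enters
only through its unweighted partials at `φ z`. -/
theorem weightedGrad_comp_le (hf : Holo f) (hφ : HoloSelfMap φ)
    (hφL : ∀ j, MemLip α fun z => (φ z).1 j) (z : polydisc n) {S : ℝ}
    (hS : ∀ j, ‖partialDeriv f j (φ z)‖ ≤ S) :
    weightedGrad α (f ∘ φ) z ≤ (∑ j, lipSeminorm α fun z => (φ z).1 j) * S := by
  calc weightedGrad α (f ∘ φ) z
      ≤ ∑ k, (1 - ‖z.1 k‖ ^ 2) ^ α * ∑ j, ‖partialDeriv (fun z => (φ z).1 j) k z‖ * S := by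
        refine Finset.sum_le_sum fun k _ =>
          mul_le_mul_of_nonneg_left ?_ (weight_pos α z k).le
        rw [partialDeriv_comp hf hφ]
        refine (norm_sum_le _ _).trans (Finset.sum_le_sum fun j _ => ?_)
        rw [norm_mul]
        exact mul_le_mul_of_nonneg_left (hS j) (norm_nonneg _)
    _ = ∑ j, weightedGrad α (fun z => (φ z).1 j) z * S := by
        simp only [weightedGrad, Finset.mul_sum, Finset.sum_mul]
        rw [Finset.sum_comm]
        exact Finset.sum_congr rfl fun j _ => Finset.sum_congr rfl fun k _ => by ring
    _ ≤ ∑ j, (lipSeminorm α fun z => (φ z).1 j) * S :=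
        Finset.sum_le_sum fun j _ => mul_le_mul_of_nonneg_right ((hφL j).weightedGrad_le z)
          ((norm_nonneg _).trans (hS j))
    _ = _ := by rw [Finset.sum_mul]

theorem MemLip.comp (hα : 0 ≤ α) (hf : MemLip α f) (hφ : HoloSelfMap φ)
    (hφL : ∀ j, MemLip α fun z => (φ z).1 j) {r : ℝ} (hr : r < 1) (hφr : ∀ z, ‖(φ z).1‖ ≤ r) :
    MemLip α (f ∘ φ) := by
  refine ⟨hf.1.comp hφ,
    (∑ j, lipSeminorm α fun z => (φ z).1 j) * (lipSeminorm α f / (1 - r) ^ α), ?_⟩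
  rintro _ ⟨z, rfl⟩
  refine weightedGrad_comp_le hf.1 hφ hφL z fun j => ?_
  exact (Finset.single_le_sum (f := fun j => ‖partialDeriv f j (φ z)‖)
    (fun _ _ => norm_nonneg _) (Finset.mem_univ j)).trans
    (hf.sum_norm_partialDeriv_le hα (φ z) hr (hφr z))

/-- Cauchy's estimate for the partial derivatives. -/
theorem Holo.norm_partialDeriv_le (hf : Holo f) {r r' M : ℝ} (hr : r < r') (hr' : r' < 1)
    (hM : ∀ z : polydisc n, ‖z.1‖ ≤ r' → ‖f z‖ ≤ M) (z : polydisc n) (hz : ‖z.1‖ ≤ r)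
    (j : Fin n) : ‖partialDeriv f j z‖ ≤ M / (r' - r) := by
  -- The disc of radius `r' - r` on this complex line stays in the ball of radius `r'`; the
  -- one-variable Cauchy estimate applies there.
  set ℓ : ℂ → (Fin n → ℂ) := fun c => z.1 + c • Pi.single j 1 with hℓ
  have hℓd : ∀ c, HasDerivAt ℓ (Pi.single j 1) c := fun c => by
    refine HasDerivAt.const_add z.1 ?_
    exact ((hasDerivAt_id c).smul_const (Pi.single j (1 : ℂ) : Fin n → ℂ)).congr_deriv
      (one_smul _ _)
  have hℓn : ∀ c, ‖c‖ ≤ r' - r → ‖ℓ c‖ ≤ r' := fun c hc => by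
    refine (norm_add_le _ _).trans ?_
    rw [norm_smul, Pi.norm_single, norm_one, mul_one]
    linarith
  have hd : ∀ c, ‖c‖ ≤ r' - r →
      HasDerivAt (fun c => ext0 f (ℓ c)) (fderiv ℂ (ext0 f) (ℓ c) (Pi.single j 1)) c := by
    intro c hc
    have h := (hf.differentiableAt ⟨ℓ c, mem_polydisc_of_norm_le hr' (hℓn c hc)⟩).hasFDerivAt
    exact h.comp_hasDerivAt c (hℓd c)
  have h0 : ℓ 0 = z.1 := by simp [hℓ]
  have h1 := (hd 0 (by simpa using hr.le)).deriv
  rw [h0] at h1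
  change deriv _ 0 = partialDeriv f j z at h1
  rw [← h1]
  refine Complex.norm_deriv_le_of_forall_mem_sphere_norm_le (sub_pos.2 hr) ?_ ?_
  · refine DifferentiableOn.diffContOnCl fun c hc => ?_
    have hc' : ‖c‖ ≤ r' - r := by
      simpa using Metric.closure_ball_subset_closedBall hc
    exact (hd c hc').differentiableAt.differentiableWithinAt
  · intro c hc
    have hc' := hℓn c (by simpa using (mem_sphere_zero_iff_norm.1 hc).le)
    have h2 := hM ⟨ℓ c, mem_polydisc_of_norm_le hr' hc'⟩ hc'
    rwa [← ext0_apply f] at h2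

/-- The restriction of a function in `L_{1-α}` to the closed ball of radius `r < 1`. -/
def LipSpace.restrict (f : LipSpace n α) {r : ℝ} (hr : r < 1) :
    BoundedContinuousFunction (Metric.closedBall (0 : Fin n → ℂ) r) ℂ :=
  BoundedContinuousFunction.mkOfCompact ⟨fun x => ext0 f.1 x, by
    refine continuous_iff_continuousAt.2 fun x => ?_
    have hx : x.1 ∈ polydisc n := mem_polydisc_of_norm_le hr (mem_closedBall_zero_iff.1 x.2)
    exact (hasFDerivAt_ext0 f hx).continuousAt.comp continuous_subtype_val.continuousAt⟩

theorem LipSpace.restrict_apply (f : LipSpace n α) {r : ℝ} (hr : r < 1)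
    (x : Metric.closedBall (0 : Fin n → ℂ) r) : f.restrict hr x = ext0 f.1 x := rfl

/-- Arzelà–Ascoli: on the smaller ball the unit ball is bounded by `1 / (1 - α)` and uniformly
Lipschitz with constant `1 / (1 - r)^α`. -/
theorem LipSpace.totallyBounded_restrict (hα0 : 0 < α) (hα1 : α < 1) {r : ℝ} (hr : r < 1) :
    TotallyBounded ((fun f : LipSpace n α => f.restrict hr) '' Metric.closedBall 0 1) := by
  have hp : 0 < (1 - r) ^ α := Real.rpow_pos_of_pos (by linarith) α
  refine ((BoundedContinuousFunction.arzela_ascoli (Metric.closedBall (0 : ℂ) (1 / (1 - α)))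
    (isCompact_closedBall _ _) _ ?_ ?_).totallyBounded).subset subset_closure
  · rintro _ x ⟨f, hf, rfl⟩
    have hx : x.1 ∈ polydisc n := mem_polydisc_of_norm_le hr (mem_closedBall_zero_iff.1 x.2)
    rw [mem_closedBall_zero_iff] at hf ⊢
    rw [LipSpace.restrict_apply, ext0_apply f.1 ⟨x.1, hx⟩]
    exact (LipSpace.norm_apply_le hα0 hα1 f ⟨x.1, hx⟩).trans
      (div_le_div_of_nonneg_right hf (by linarith))
  · refine (LipschitzWith.uniformEquicontinuous _
      (Real.toNNReal (1 / (1 - r) ^ α)) ?_).equicontinuous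
    rintro ⟨_, f, hf, rfl⟩
    rw [mem_closedBall_zero_iff] at hf
    refine LipschitzWith.of_dist_le_mul fun x y => ?_
    have hmem : ∀ x ∈ Metric.closedBall (0 : Fin n → ℂ) r, ‖x‖ ≤ r := fun x hx => by
      simpa using hx
    have h := (convex_closedBall (0 : Fin n → ℂ) r).norm_image_sub_le_of_norm_fderiv_le (𝕜 := ℂ)
      (f := ext0 f.1) (C := 1 / (1 - r) ^ α)
      (fun x hx => (hasFDerivAt_ext0 f
        (mem_polydisc_of_norm_le hr (hmem x hx))).differentiableAt)
      (fun x hx => (MemLip.norm_fderiv_ext0_le hα0.le f.2 hr (hmem x hx)).trans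
        (div_le_div_of_nonneg_right ((LipSpace.lipSeminorm_le_norm f).trans hf) hp.le))
      y.2 x.2
    rw [Real.coe_toNNReal _ (by positivity), dist_eq_norm, Subtype.dist_eq, dist_eq_norm]
    exact h

theorem exists_lt_one_norm_le (h : ∀ j, (⨆ z, ‖(φ z).1 j‖) < 1) :
    ∃ r, 0 ≤ r ∧ r < 1 ∧ ∀ z, ‖(φ z).1‖ ≤ r := by
  have h1 : ∀ᶠ r in 𝓝[<] (1 : ℝ), ∀ j, (⨆ z, ‖(φ z).1 j‖) ≤ r :=
    eventually_all.2 fun j => mem_nhdsWithin_of_mem_nhds (Ici_mem_nhds (h j))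
  have h2 : ∀ᶠ r in 𝓝[<] (1 : ℝ), 0 ≤ r := mem_nhdsWithin_of_mem_nhds (Ici_mem_nhds one_pos)
  obtain ⟨r, ⟨hr1, hr2⟩, hr3⟩ := ((h1.and h2).and self_mem_nhdsWithin).exists
  refine ⟨r, hr2, hr3, fun z => (pi_norm_le_iff_of_nonneg hr2).2 fun j => ?_⟩
  refine (le_ciSup (f := fun z => ‖(φ z).1 j‖) ⟨1, ?_⟩ z).trans (hr1 j)
  rintro _ ⟨w, rfl⟩
  exact ((φ w).2 j).le

theorem compactCompOp_of_memLip (hα0 : 0 < α) (hα1 : α < 1) (hφ : HoloSelfMap φ)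
    (hφL : ∀ j, MemLip α fun z => (φ z).1 j) (hsup : ∀ j, (⨆ z, ‖(φ z).1 j‖) < 1) :
    CompactCompOp α φ := by
  obtain ⟨r, hr0, hr1, hφr⟩ := exists_lt_one_norm_le hsup
  obtain ⟨r', hr, hr'⟩ := exists_between hr1
  let T : LipSpace n α →ₗ[ℂ] LipSpace n α :=
    { toFun := fun f => ⟨f.1 ∘ φ, MemLip.comp hα0.le f.2 hφ hφL hr1 hφr⟩
      map_add' := fun f g => rfl
      map_smul' := fun c f => rfl }
  have hT : ∀ (f : LipSpace n α) z, T f z = f (φ z) := fun f z => rfl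
  refine ⟨T, hT, ?_⟩
  set C : ℝ := 1 + (∑ j, lipSeminorm α fun z => (φ z).1 j) / (r' - r) with hC
  have hL : 0 ≤ ∑ j, lipSeminorm α fun z => (φ z).1 j :=
    Finset.sum_nonneg fun j _ => lipSeminorm_nonneg _ _
  have hC0 : 0 < C := by
    have := div_nonneg hL (sub_pos.2 hr).le
    linarith
  -- `T` is controlled by the supremum on the ball of radius `r'` alone; the gap `r' - r` pays for
  -- Cauchy's estimate.
  have hbound : ∀ (f : LipSpace n α) (M : ℝ), (∀ z : polydisc n, ‖z.1‖ ≤ r' → ‖f z‖ ≤ M) →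
      ‖T f‖ ≤ C * M := by
    intro f M hM
    have hM0 : 0 ≤ M := (norm_nonneg _).trans (hM (φ (origin n)) ((hφr _).trans hr.le))
    have h1 : ‖T f (origin n)‖ ≤ M := hM (φ (origin n)) ((hφr _).trans hr.le)
    have h2 : lipSeminorm α (T f).1 ≤
        (∑ j, lipSeminorm α fun z => (φ z).1 j) * (M / (r' - r)) :=
      Real.iSup_le (fun z => weightedGrad_comp_le f.2.1 hφ hφL z fun j =>
          Holo.norm_partialDeriv_le f.2.1 hr hr' hM (φ z) (hφr z) j)
        (mul_nonneg hL (div_nonneg hM0 (sub_pos.2 hr).le))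
    rw [LipSpace.norm_def, hC]
    calc _ ≤ M + (∑ j, lipSeminorm α fun z => (φ z).1 j) * (M / (r' - r)) := add_le_add h1 h2
      _ = _ := by ring
  have := LipSpace.completeSpace (n := n) hα0 hα1
  refine (isCompactOperator_iff_isCompact_closure_image_closedBall T one_pos).2
    ((TotallyBounded.closure ?_).isCompact_of_isClosed isClosed_closure)
  rw [Metric.totallyBounded_iff]
  intro ε hε
  -- The centres of the finite net are chosen among restrictions, so that `T` can be applied to the
  -- functions themselves.
  obtain ⟨t, ht1, ht2, ht3⟩ := Set.exists_subset_image_finite_and.1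
    (totallyBounded_iff_subset.1 (LipSpace.totallyBounded_restrict (n := n) hα0 hα1 hr') _
      (Metric.dist_mem_uniformity (show 0 < ε / (2 * C) by positivity)))
  refine ⟨T '' t, ht2.image _, ?_⟩
  rintro _ ⟨f, hf, rfl⟩
  obtain ⟨_, ⟨g, hg, rfl⟩, hfg⟩ := Set.mem_iUnion₂.1 (ht3 ⟨f, hf, rfl⟩)
  refine Set.mem_iUnion₂.2 ⟨T g, ⟨g, hg, rfl⟩, ?_⟩
  rw [Metric.mem_ball, dist_eq_norm, ← map_sub]
  refine (hbound (f - g) (ε / (2 * C)) fun z hz => ?_).trans_lt ?_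
  · have h := (BoundedContinuousFunction.dist_coe_le_dist
      (⟨z.1, by simpa using hz⟩ : Metric.closedBall (0 : Fin n → ℂ) r')).trans hfg.le
    rw [LipSpace.restrict_apply, LipSpace.restrict_apply, ext0_apply, ext0_apply,
      dist_eq_norm] at h
    exact h
  · have : C * (ε / (2 * C)) = ε / 2 := by field_simp
    linarith

end sufficiency

/-! ### Test functions and the lower bound from Schwarz–Pick. -/

section necessity

variable {n : ℕ} {α : ℝ} {f g : polydisc n → ℂ} {φ : polydisc n → polydisc n}

theorem hasFDerivAt_ext0_comp_coord {h h' : ℂ → ℂ} (hh : ∀ c, ‖c‖ < 1 → HasDerivAt h (h' c) c)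
    (j : Fin n) (z : polydisc n) :
    HasFDerivAt (ext0 fun z : polydisc n => h (z.1 j))
      (h' (z.1 j) • (ContinuousLinearMap.proj j : (Fin n → ℂ) →L[ℂ] ℂ)) z := by
  have h1 := (hh (z.1 j) (z.2 j)).comp_hasFDerivAt z.1 (hasFDerivAt_apply (𝕜 := ℂ) j z.1)
  refine h1.congr_of_eventuallyEq ?_
  filter_upwards [(isOpen_polydisc n).mem_nhds z.2] with w hw
  exact ext0_apply (fun z : polydisc n => h (z.1 j)) ⟨w, hw⟩

theorem weightedGrad_comp_coord {h h' : ℂ → ℂ} (hh : ∀ c, ‖c‖ < 1 → HasDerivAt h (h' c) c)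
    (j : Fin n) (z : polydisc n) :
    weightedGrad α (fun z : polydisc n => h (z.1 j)) z =
      (1 - ‖z.1 j‖ ^ 2) ^ α * ‖h' (z.1 j)‖ := by
  rw [weightedGrad, Finset.sum_eq_single j]
  · rw [partialDeriv, (hasFDerivAt_ext0_comp_coord hh j z).fderiv]
    simp
  · intro k _ hk
    rw [partialDeriv, (hasFDerivAt_ext0_comp_coord hh j z).fderiv]
    simp [hk.symm]
  · simp

theorem memLip_comp_coord {h h' : ℂ → ℂ} {C : ℝ} (hh : ∀ c, ‖c‖ < 1 → HasDerivAt h (h' c) c)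
    (hC : ∀ c, ‖c‖ < 1 → (1 - ‖c‖ ^ 2) ^ α * ‖h' c‖ ≤ C) (j : Fin n) :
    MemLip α fun z : polydisc n => h (z.1 j) := by
  refine ⟨fun z hz =>
    (hasFDerivAt_ext0_comp_coord hh j ⟨z, hz⟩).differentiableAt.differentiableWithinAt, C, ?_⟩
  rintro _ ⟨z, rfl⟩
  rw [weightedGrad_comp_coord hh]
  exact hC _ (z.2 j)

theorem lipSeminorm_comp_coord_le {h h' : ℂ → ℂ} {C : ℝ}
    (hh : ∀ c, ‖c‖ < 1 → HasDerivAt h (h' c) c)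
    (hC : ∀ c, ‖c‖ < 1 → (1 - ‖c‖ ^ 2) ^ α * ‖h' c‖ ≤ C) (j : Fin n) :
    lipSeminorm α (fun z : polydisc n => h (z.1 j)) ≤ C := by
  have : Nonempty (polydisc n) := ⟨origin n⟩
  refine ciSup_le fun z => ?_
  rw [weightedGrad_comp_coord hh]
  exact hC _ (z.2 j)

theorem memLip_coord (hα : 0 ≤ α) (j : Fin n) : MemLip α fun z : polydisc n => z.1 j := by
  refine memLip_comp_coord (h := fun c => c) (h' := fun _ => 1) (C := 1)
    (fun c _ => hasDerivAt_id c) (fun c hc => ?_) j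
  rw [norm_one, mul_one]
  exact Real.rpow_le_one (by nlinarith [norm_nonneg c]) (by nlinarith [norm_nonneg c]) hα

theorem one_sub_norm_le_norm_one_sub_conj_mul {w c : ℂ} (hw : ‖w‖ ≤ 1) :
    1 - ‖c‖ ≤ ‖1 - conj w * c‖ := by
  have h1 := norm_sub_norm_le (1 : ℂ) (conj w * c)
  rw [norm_one, norm_mul, Complex.norm_conj] at h1
  nlinarith [norm_nonneg c]

theorem one_sub_norm_le_norm_one_sub_conj_mul' {w c : ℂ} (hc : ‖c‖ ≤ 1) :
    1 - ‖w‖ ≤ ‖1 - conj w * c‖ := by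
  have h1 := norm_sub_norm_le (1 : ℂ) (conj w * c)
  rw [norm_one, norm_mul, Complex.norm_conj] at h1
  nlinarith [norm_nonneg w]

/-- The function `c ↦ (1 - |w|²)^(2-α) / (1 - w̄ c)` on the unit disc. -/
def kernelFun (α : ℝ) (w c : ℂ) : ℂ := ((1 - ‖w‖ ^ 2) ^ (2 - α) : ℝ) / (1 - conj w * c)

/-- The derivative of `kernelFun`. -/
def kernelDeriv (α : ℝ) (w c : ℂ) : ℂ :=
  ((1 - ‖w‖ ^ 2) ^ (2 - α) : ℝ) * conj w / (1 - conj w * c) ^ 2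

theorem one_sub_conj_mul_ne_zero {w c : ℂ} (hw : ‖w‖ ≤ 1) (hc : ‖c‖ < 1) :
    1 - conj w * c ≠ 0 := by
  have h := one_sub_norm_le_norm_one_sub_conj_mul (c := c) hw
  exact norm_pos_iff.1 (by linarith)

theorem hasDerivAt_kernelFun {w c : ℂ} (hw : ‖w‖ ≤ 1) (hc : ‖c‖ < 1) :
    HasDerivAt (kernelFun α w) (kernelDeriv α w c) c := by
  have h1 : HasDerivAt (fun c => 1 - conj w * c) (-(conj w * 1)) c :=
    ((hasDerivAt_id c).const_mul (conj w)).const_sub 1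
  refine ((hasDerivAt_const c _).div h1 (one_sub_conj_mul_ne_zero hw hc)).congr_deriv ?_
  rw [kernelDeriv]
  ring

theorem one_sub_norm_sq_pos {w : ℂ} (hw : ‖w‖ < 1) : 0 < 1 - ‖w‖ ^ 2 := by
  nlinarith [norm_nonneg w]

theorem norm_kernelFun {w : ℂ} (hw : ‖w‖ < 1) (c : ℂ) :
    ‖kernelFun α w c‖ = (1 - ‖w‖ ^ 2) ^ (2 - α) / ‖1 - conj w * c‖ := by
  rw [kernelFun, norm_div, Complex.norm_real,
    Real.norm_of_nonneg (Real.rpow_nonneg (one_sub_norm_sq_pos hw).le _)]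

/-- Both `1 - |c|²` and `1 - |w|²` are at most `2|1 - w̄c|`; the exponents `α` and `2 - α` add up to
`2` and cancel the squared denominator, leaving `4`. -/
theorem weight_mul_norm_kernelDeriv_le (hα0 : 0 < α) (hα1 : α < 1) {w c : ℂ} (hw : ‖w‖ < 1)
    (hc : ‖c‖ < 1) : (1 - ‖c‖ ^ 2) ^ α * ‖kernelDeriv α w c‖ ≤ 4 := by
  have hd := one_sub_norm_sq_pos hw
  have hd' := one_sub_norm_sq_pos hc
  rw [kernelDeriv, norm_div, norm_mul, Complex.norm_real,
    Real.norm_of_nonneg (Real.rpow_nonneg hd.le _), Complex.norm_conj, norm_pow]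
  set e := ‖1 - conj w * c‖ with he
  have h1 : 1 - ‖c‖ ≤ e := one_sub_norm_le_norm_one_sub_conj_mul hw.le
  have h2 : 1 - ‖w‖ ≤ e := one_sub_norm_le_norm_one_sub_conj_mul' hc.le
  have he0 : 0 < e := by linarith
  have h3 : (1 - ‖c‖ ^ 2) ^ α ≤ (2 * e) ^ α :=
    Real.rpow_le_rpow hd'.le (by nlinarith [norm_nonneg c]) hα0.le
  have h4 : (1 - ‖w‖ ^ 2) ^ (2 - α) ≤ (2 * e) ^ (2 - α) :=
    Real.rpow_le_rpow hd.le (by nlinarith [norm_nonneg w]) (by linarith)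
  have h5 : (2 * e) ^ α * (2 * e) ^ (2 - α) = (2 * e) ^ 2 := by
    rw [← Real.rpow_add (by positivity), add_sub_cancel, Real.rpow_two]
  rw [mul_div_assoc', div_le_iff₀ (by positivity)]
  calc (1 - ‖c‖ ^ 2) ^ α * ((1 - ‖w‖ ^ 2) ^ (2 - α) * ‖w‖)
      ≤ (2 * e) ^ α * ((2 * e) ^ (2 - α) * 1) := by gcongr
    _ = 4 * e ^ 2 := by rw [mul_one, h5]; ring

/-- `kernelFun` of the `j`-th coordinate, as an element of `L_{1-α}`. -/
def kernelLip (hα0 : 0 < α) (hα1 : α < 1) (j : Fin n) (w : ℂ) (hw : ‖w‖ < 1) : LipSpace n α :=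
  ⟨fun z => kernelFun α w (z.1 j), memLip_comp_coord (fun _ hc => hasDerivAt_kernelFun hw.le hc)
    (fun _ hc => weight_mul_norm_kernelDeriv_le hα0 hα1 hw hc) j⟩

theorem kernelLip_apply (hα0 : 0 < α) (hα1 : α < 1) (j : Fin n) (w : ℂ) (hw : ‖w‖ < 1)
    (z : polydisc n) : kernelLip hα0 hα1 j w hw z = kernelFun α w (z.1 j) := rfl

/-- One factor `1 - |w|²` cancels the denominator up to `2`. As `1 - α > 0`, the functions tend to
`0` uniformly when `|w| → 1`. -/
theorem norm_kernelFun_le {w c : ℂ} (hw : ‖w‖ < 1) (hc : ‖c‖ < 1) :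
    ‖kernelFun α w c‖ ≤ 2 * (1 - ‖w‖ ^ 2) ^ (1 - α) := by
  have hd := one_sub_norm_sq_pos hw
  have h2 : 1 - ‖w‖ ≤ ‖1 - conj w * c‖ := one_sub_norm_le_norm_one_sub_conj_mul' hc.le
  rw [norm_kernelFun hw, div_le_iff₀ (by linarith),
    show 2 - α = 1 - α + 1 by ring, Real.rpow_add hd, Real.rpow_one, mul_right_comm,
    mul_comm]
  refine mul_le_mul_of_nonneg_right ?_ (Real.rpow_nonneg hd.le _)
  nlinarith [norm_nonneg w]

theorem norm_kernelLip_le (hα0 : 0 < α) (hα1 : α < 1) (j : Fin n) (w : ℂ) (hw : ‖w‖ < 1) :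
    ‖kernelLip hα0 hα1 j w hw‖ ≤ 6 := by
  have h1 : lipSeminorm α (kernelLip hα0 hα1 j w hw).1 ≤ 4 :=
    lipSeminorm_comp_coord_le (fun _ hc => hasDerivAt_kernelFun hw.le hc)
      (fun _ hc => weight_mul_norm_kernelDeriv_le hα0 hα1 hw hc) j
  have h2 : ‖kernelLip hα0 hα1 j w hw (origin n)‖ ≤ 2 := by
    rw [kernelLip_apply]
    refine (norm_kernelFun_le hw ((origin n).2 j)).trans ?_
    have := Real.rpow_le_one (one_sub_norm_sq_pos hw).le (by nlinarith [norm_nonneg w])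
      (show 0 ≤ 1 - α by linarith)
    linarith
  rw [LipSpace.norm_def]
  linarith

/-- The identity behind the Möbius automorphisms of the disc: it shows that they preserve the disc
and measures the distance of the image to the circle. -/
theorem norm_one_sub_conj_mul_sq_sub (a b : ℂ) :
    ‖1 - conj a * b‖ ^ 2 - ‖b - a‖ ^ 2 = (1 - ‖a‖ ^ 2) * (1 - ‖b‖ ^ 2) := by
  simp only [Complex.sq_norm, Complex.normSq_apply]
  simp
  ring

/-- A form of the Schwarz–Pick inequality on the polydisc. -/
theorem Holo.one_sub_norm_ge (hg : Holo g) (hg1 : ∀ z, ‖g z‖ < 1) (z : polydisc n) {t : ℝ}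
    (ht : t ≤ 1) (hz : ‖z.1‖ ≤ t) : (1 - ‖g (origin n)‖) / 4 * (1 - t) ≤ 1 - ‖g z‖ := by
  set a := g (origin n) with ha
  have ha1 : ‖a‖ < 1 := hg1 _
  -- The Schwarz lemma on the unit ball of the sup norm, for `g` followed by the automorphism
  -- sending `g(0)` to `0`.
  have key := Complex.norm_le_norm_of_mapsTo_ball (R := 1)
    (f := fun x => (ext0 g x - a) / (1 - conj a * ext0 g x)) (z := z.1) ?_ ?_ ?_ (norm_lt_one z)
  · simp only [ext0_apply] at key
    set b := g z with hb
    have hb1 : ‖b‖ < 1 := hg1 z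
    have he : 0 < ‖1 - conj a * b‖ := norm_pos_iff.2 (one_sub_conj_mul_ne_zero ha1.le hb1)
    rw [norm_div, div_le_iff₀ he] at key
    have h1 := norm_one_sub_conj_mul_sq_sub a b
    have h2 : 1 - ‖a‖ ≤ ‖1 - conj a * b‖ := one_sub_norm_le_norm_one_sub_conj_mul' hb1.le
    have ht0 : 0 ≤ t := (norm_nonneg _).trans hz
    have h3 : ‖b - a‖ ≤ t * ‖1 - conj a * b‖ :=
      key.trans (mul_le_mul_of_nonneg_right hz he.le)
    have h4 : ‖b - a‖ ^ 2 ≤ (t * ‖1 - conj a * b‖) ^ 2 :=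
      pow_le_pow_left₀ (norm_nonneg _) h3 2
    have h5 : (1 - ‖a‖) ^ 2 ≤ ‖1 - conj a * b‖ ^ 2 := pow_le_pow_left₀ (by linarith) h2 2
    have h6 : (1 - t) * (1 - ‖a‖) ^ 2 ≤ (1 - ‖a‖ ^ 2) * (1 - ‖b‖ ^ 2) := by
      rw [← h1]
      calc (1 - t) * (1 - ‖a‖) ^ 2 ≤ (1 - t ^ 2) * ‖1 - conj a * b‖ ^ 2 := by
            refine mul_le_mul ?_ h5 (sq_nonneg _) ?_ <;> nlinarith
        _ ≤ _ := by nlinarith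
    have h7 : (1 - ‖a‖) * ((1 - t) * (1 - ‖a‖)) ≤ (1 - ‖a‖) * (4 * (1 - ‖b‖)) := by
      calc _ = (1 - t) * (1 - ‖a‖) ^ 2 := by ring
        _ ≤ _ := h6
        _ = (1 - ‖a‖) * ((1 + ‖a‖) * ((1 + ‖b‖) * (1 - ‖b‖))) := by ring
        _ ≤ _ := by
          refine mul_le_mul_of_nonneg_left ?_ (by linarith)
          rw [← mul_assoc]
          refine mul_le_mul_of_nonneg_right ?_ (by linarith)
          nlinarith [norm_nonneg a, norm_nonneg b]
    have h8 := le_of_mul_le_mul_left h7 (by linarith)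
    linarith
  · rw [← polydisc_eq_ball]
    simp only [div_eq_mul_inv]
    refine DifferentiableOn.mul (DifferentiableOn.sub_const hg a)
      (DifferentiableOn.inv ((DifferentiableOn.const_mul hg (conj a)).const_sub 1) fun x hx => ?_)
    rw [ext0_apply g ⟨x, hx⟩]
    exact one_sub_conj_mul_ne_zero ha1.le (hg1 _)
  · rw [← polydisc_eq_ball]
    intro x hx
    rw [mem_closedBall_zero_iff, norm_div, ext0_apply g ⟨x, hx⟩]
    refine div_le_one_of_le₀ ?_ (norm_nonneg _)
    refine le_of_sq_le_sq ?_ (norm_nonneg _)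
    have h1 := norm_one_sub_conj_mul_sq_sub a (g ⟨x, hx⟩)
    have h2 := mul_pos (one_sub_norm_sq_pos ha1) (one_sub_norm_sq_pos (hg1 ⟨x, hx⟩))
    linarith
  · have : ext0 g 0 = a := ext0_apply g (origin n)
    simp [this]

/-- Compares the values at `z` and at `(1 - M d) z`: a drop of at least `d^(1-α) / 2` against a
Hölder bound proportional to `(M d)^(1-α)`. The powers of `d` cancel, so the bound does not depend
on `z`. -/
theorem le_lipSeminorm_kernelFun_comp (hα0 : 0 < α) (hα1 : α < 1) (hg : Holo g)
    (hg1 : ∀ z, ‖g z‖ < 1) (z : polydisc n) {M : ℝ}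
    (hM : 2 / ((1 - ‖g (origin n)‖) / 4) ≤ M) (hd : M * (1 - ‖g z‖ ^ 2) ≤ 1)
    (hmem : MemLip α fun x => kernelFun α (g z) (g x)) :
    (1 - α) / (2 * M ^ (1 - α)) ≤ lipSeminorm α fun x => kernelFun α (g z) (g x) := by
  have hc0 : 0 < (1 - ‖g (origin n)‖) / 4 := by linarith [hg1 (origin n)]
  have hM0 : 0 < M := (div_pos two_pos hc0).trans_le hM
  set d := 1 - ‖g z‖ ^ 2 with hdd
  have hd0 : 0 < d := one_sub_norm_sq_pos (hg1 z)
  have hMd : 0 < M * d := mul_pos hM0 hd0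
  have ht : 1 - M * d ∈ Set.Icc (0 : ℝ) 1 := ⟨by linarith, by linarith⟩
  set y := dilate z (1 - M * d) ht with hy
  have h1 := hmem.norm_sub_dilate_le hα0 hα1 z (1 - M * d) ht
  rw [← hy, sub_sub_cancel] at h1
  have h2 : ‖kernelFun α (g z) (g z)‖ = d ^ (1 - α) := by
    have e : 1 - conj (g z) * g z = (d : ℂ) := by
      rw [mul_comm, Complex.mul_conj, Complex.normSq_eq_norm_sq, hdd]
      push_cast
      ring
    rw [norm_kernelFun (hg1 z), e, Complex.norm_real, Real.norm_of_nonneg hd0.le, ← hdd,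
      show 2 - α = 1 - α + 1 by ring, Real.rpow_add hd0, Real.rpow_one,
      mul_div_cancel_right₀ _ hd0.ne']
  have h3 : ‖kernelFun α (g z) (g y)‖ ≤ d ^ (1 - α) / 2 := by
    have h4 := hg.one_sub_norm_ge hg1 y ht.2 (norm_dilate_le z _ ht)
    -- Schwarz–Pick gives `1 - |g y| ≥ (1 - |g(0)|)/4 · M d`, and `M` is large enough for this to be
    -- at least `2d`.
    have h5 : 2 * d ≤ ‖1 - conj (g z) * g y‖ := by
      refine le_trans ?_ (h4.trans (one_sub_norm_le_norm_one_sub_conj_mul (hg1 z).le))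
      rw [sub_sub_cancel, ← mul_assoc]
      refine mul_le_mul_of_nonneg_right ?_ hd0.le
      rwa [div_le_iff₀' hc0] at hM
    rw [norm_kernelFun (hg1 z), ← hdd, show 2 - α = 1 - α + 1 by ring, Real.rpow_add hd0,
      Real.rpow_one]
    calc _ ≤ d ^ (1 - α) * d / (2 * d) := by gcongr
      _ = _ := by field_simp
  have h6 : d ^ (1 - α) / 2 ≤ ‖kernelFun α (g z) (g z) - kernelFun α (g z) (g y)‖ := by
    have := norm_sub_norm_le (kernelFun α (g z) (g z)) (kernelFun α (g z) (g y))
    linarith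
  have h7 := h6.trans h1
  have hdp : 0 < d ^ (1 - α) := Real.rpow_pos_of_pos hd0 _
  have hMp : 0 < M ^ (1 - α) := Real.rpow_pos_of_pos hM0 _
  have hα : 0 < 1 - α := by linarith
  rw [Real.mul_rpow hM0.le hd0.le, le_div_iff₀ hα] at h7
  rw [div_le_iff₀ (by positivity)]
  refine le_of_mul_le_mul_left ?_ hdp
  linarith

theorem iSup_norm_lt_one_of_isCompactOperator (hα0 : 0 < α) (hα1 : α < 1) (hφ : HoloSelfMap φ)
    {T : LipSpace n α →ₗ[ℂ] LipSpace n α} (hT : ∀ (f : LipSpace n α) z, T f z = f (φ z))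
    (hTc : IsCompactOperator T) (j : Fin n) : (⨆ z, ‖(φ z).1 j‖) < 1 := by
  by_contra! hsup
  have : Nonempty (polydisc n) := ⟨origin n⟩
  set g : polydisc n → ℂ := fun z => (φ z).1 j with hg
  have hg1 : ∀ z, ‖g z‖ < 1 := fun z => (φ z).2 j
  have hex : ∀ m : ℕ, ∃ z, 1 - 1 / ((m : ℝ) + 1) < ‖g z‖ := fun m =>
    exists_lt_of_lt_ciSup ((sub_lt_self _ Nat.one_div_pos_of_nat).trans_le hsup)
  choose z hz using hex
  have hnorm : Tendsto (fun m => ‖g (z m)‖) atTop (𝓝 1) := by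
    refine tendsto_of_tendsto_of_tendsto_of_le_of_le (g := fun m : ℕ => 1 - 1 / ((m : ℝ) + 1))
      (h := fun _ => 1) ?_ tendsto_const_nhds (fun m => (hz m).le) (fun m => (hg1 _).le)
    simpa using (tendsto_one_div_add_atTop_nhds_zero_nat (𝕜 := ℝ)).const_sub 1
  have hd : Tendsto (fun m => 1 - ‖g (z m)‖ ^ 2) atTop (𝓝 0) := by
    simpa using (hnorm.pow 2).const_sub 1
  set u : ℕ → LipSpace n α := fun m => kernelLip hα0 hα1 j (g (z m)) (hg1 _) with hu
  -- The radius `6` is the uniform norm bound for the test functions.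
  obtain ⟨K, hK, hsub⟩ := hTc.image_closedBall_subset_compact 6
  obtain ⟨G, -, ψ, hψ, hlim⟩ := hK.tendsto_subseq (x := fun m => T (u m)) fun m =>
    hsub ⟨u m, by simpa using norm_kernelLip_le hα0 hα1 j (g (z m)) (hg1 _), rfl⟩
  have hTu : ∀ m, (T (u m)).1 = fun x => kernelFun α (g (z m)) (g x) := fun m => by
    funext x
    exact hT (u m) x
  have hpow : Tendsto (fun m => 2 * (1 - ‖g (z m)‖ ^ 2) ^ (1 - α)) atTop (𝓝 0) := by
    have h := (hd.rpow_const (p := 1 - α) (Or.inr (by linarith))).const_mul 2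
    rwa [Real.zero_rpow (by linarith), mul_zero] at h
  -- Norm convergence forces pointwise convergence, and the images tend to `0` pointwise.
  have hG : G = 0 := by
    refine Subtype.ext (funext fun x => ?_)
    change G x = 0
    have h1 : Tendsto (fun k => T (u (ψ k)) x) atTop (𝓝 (G x)) := by
      rw [tendsto_iff_norm_sub_tendsto_zero] at hlim ⊢
      refine squeeze_zero (fun _ => norm_nonneg _)
        (fun k => LipSpace.norm_apply_le hα0 hα1 (T (u (ψ k)) - G) x) ?_
      simpa using hlim.div_const (1 - α)
    have h2 : Tendsto (fun k => T (u (ψ k)) x) atTop (𝓝 0) := by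
      refine squeeze_zero_norm (fun k => ?_) (hpow.comp hψ.tendsto_atTop)
      rw [hTu]
      exact norm_kernelFun_le (hg1 _) (hg1 _)
    exact tendsto_nhds_unique h1 h2
  rw [hG] at hlim
  set M : ℝ := 2 / ((1 - ‖g (origin n)‖) / 4) with hM
  have hM0 : 0 < M := by
    have := hg1 (origin n)
    exact div_pos two_pos (by linarith)
  have hκ : 0 < (1 - α) / (2 * M ^ (1 - α)) :=
    div_pos (by linarith) (mul_pos two_pos (Real.rpow_pos_of_pos hM0 _))
  -- Ensures that the comparison point `(1 - M d) z` lies on the radius.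
  have hMd : ∀ᶠ k in atTop, M * (1 - ‖g (z (ψ k))‖ ^ 2) < 1 := by
    have h := (hd.comp hψ.tendsto_atTop).const_mul M
    rw [mul_zero] at h
    exact h.eventually_lt_const one_pos
  have hsmall : ∀ᶠ k in atTop, ‖T (u (ψ k))‖ < (1 - α) / (2 * M ^ (1 - α)) := by
    have h := hlim.norm
    rw [norm_zero] at h
    exact h.eventually_lt_const hκ
  obtain ⟨k, hk1, hk2⟩ := (hMd.and hsmall).exists
  have hmem := (T (u (ψ k))).2
  have hle := LipSpace.lipSeminorm_le_norm (T (u (ψ k)))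
  have hmem' : MemLip α (T (u (ψ k))).1 := hmem
  rw [hTu] at hmem' hle
  exact absurd ((le_lipSeminorm_kernelFun_comp hα0 hα1 (hφ j) hg1 (z (ψ k)) hM.ge hk1.le
    hmem').trans hle) (not_le.2 hk2)

theorem memLip_of_comp_operator (hα0 : 0 < α) {T : LipSpace n α →ₗ[ℂ] LipSpace n α}
    (hT : ∀ (f : LipSpace n α) z, T f z = f (φ z)) (j : Fin n) :
    MemLip α fun z => (φ z).1 j := by
  have h : (T ⟨_, memLip_coord hα0.le j⟩).1 = fun z => (φ z).1 j := funext fun z => hT _ z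
  rw [← h]
  exact (T _).2

end necessity

end

end PolydiscLip

theorem theorem2 (n : ℕ) (α : ℝ) (hα0 : 0 < α) (hα1 : α < 1)
    (φ : PolydiscLip.polydisc n → PolydiscLip.polydisc n) (hφ : PolydiscLip.HoloSelfMap φ) :
    PolydiscLip.CompactCompOp α φ ↔
      ∀ j : Fin n, PolydiscLip.MemLip α (fun z => (φ z).1 j) ∧
        (⨆ z : PolydiscLip.polydisc n, ‖(φ z).1 j‖) < 1 := by
  refine ⟨?_, fun h => PolydiscLip.compactCompOp_of_memLip hα0 hα1 hφ (fun j => (h j).1)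
    fun j => (h j).2⟩
  rintro ⟨T, hT, hTc⟩ j
  exact ⟨PolydiscLip.memLip_of_comp_operator hα0 hT j,
    PolydiscLip.iSup_norm_lt_one_of_isCompactOperator hα0 hα1 hφ hT hTc j⟩
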